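/- All graphs are finite and simple; $G$ has girth at least $g$ if every cycle of $G$ has length at least $g$ (so forests have infinite girth). A partition of a positive integer $k$ is a finite multiset $\lambda=\{k_1,\dots,k_q\}$ of positive integers with $k_1+\dots+k_q=k$. A $\lambda$-assignment of a graph $G$ is a map $L$ assigning to each vertex $v$ a set $L(v)$ of exactly $k$ colours such that $\bigcup_{v\in V(G)}L(v)$ can be partitioned into sets $C_1,\dots,C_q$ with $|L(v)\cap C_i|=k_i$ for every vertex $v$ and every $1\le i\le q$. The graph $G$ is $\lambda$-choosable if for every $\lambda$-assignment $L$ there is a proper colouring $f$ of $G$ with $f(v)\in L(v)$ for all $v$. For a partition $\lambda=\{k_1,\dots,k_q\}$ of $k$ and a partition $\lambda'$ of $k'$, write $\lambda\le\lambda'$ if there is a partition $\lambda''=\{k''_1,\dots,k''_q\}$ of $k'$ with $k''_i\ge k_i$ for $i=1,\dots,q$ such that $\lambda'$ is a refinement of $\lambda''$, that is, $\lambda'$ is obtained from $\lambda''$ by replacing some parts by partitions of these parts. (In particular $\lambda\le\lambda'$ implies $k\le k'$.) **Theorem.** Let $\lambda$ be a partition of a positive integer $k$ and $\lambda'$ a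 partition of a positive integer $k'$ such that $\lambda\not\le\lambda'$. Then for every positive integer $g$ there is a graph $G$ of girth at least $g$ which is $\lambda$-choosable but not $\lambda'$-choosable. -/

import Mathlib

universe u

/-- The parts of a partition `lam`, listed in a fixed (arbitrary) order `k_1, ..., k_q`, where
`q = lam.parts.card` is the number of parts counted with multiplicity. -/
noncomputable def partOf {n : ℕ} (lam : n.Partition) (i : Fin lam.parts.card) : ℕ :=
  lam.parts.toList.get (i.cast (Multiset.length_toList lam.parts).symm)

theorem map_partOf {n : ℕ} (lam : n.Partition) :
    Finset.univ.val.map (partOf lam) = lam.parts := by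
  have h := Multiset.length_toList lam.parts
  conv_rhs => rw [← Multiset.coe_toList lam.parts]
  rw [Fin.univ_val_map]
  congr 1
  apply List.ext_get
  · simp
  · intro m h1 h2
    simp [partOf]

/-- `μ` is a refinement of `lam` (both partitions of `n`): `μ` is obtained from `lam` by replacing
each part of `lam` by a partition of that part (an unchanged part is replaced by its one-part
partition). -/
def IsRefinement {n : ℕ} (μ lam : n.Partition) : Prop :=
  ∃ P : ∀ i, (partOf lam i).Partition, ∑ i, (P i).parts = μ.parts

/-- The relation `lam ≤ lam'` for a partition `lam` of `k` and a partition `lam'` of `k'`: there is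
a partition `μ` of `k'` whose parts can be matched one-to-one with the parts of `lam` so that every
part of `lam` is at most its partner, and such that `lam'` is a refinement of `μ`.
(This forces `k ≤ k'`.) -/
def PartitionLE {k k' : ℕ} (lam : k.Partition) (lam' : k'.Partition) : Prop :=
  ∃ μ : k'.Partition, Multiset.Rel (· ≤ ·) lam.parts μ.parts ∧ IsRefinement lam' μ

/-- `L` is a `lam`-assignment: a `k`-assignment such that the set of all colours occurring in the
lists can be partitioned into sets `A i`, one for each part `k_i` of `lam`, where each list contains
exactly `k_i` colours of `A i`. -/
def IsPartitionAssignment {V C : Type u} {k : ℕ} (lam : k.Partition) (L : V → Finset C) : Prop :=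
  (∀ v, (L v).card = k) ∧
    ∃ A : Fin lam.parts.card → Set C,
      Pairwise (fun i j => Disjoint (A i) (A j)) ∧
      ⋃ i, A i = ⋃ v, (L v : Set C) ∧
      ∀ v i, ((L v : Set C) ∩ A i).ncard = partOf lam i

/-- `G` is `L`-colourable: it has a proper colouring that takes the colour of each vertex from the
list of that vertex. -/
def IsListColourable {V C : Type u} (G : SimpleGraph V) (L : V → Finset C) : Prop :=
  ∃ φ : G.Coloring C, ∀ v, φ v ∈ L v

/-- `G` is `lam`-choosable: it is `L`-colourable for every `lam`-assignment `L`, with colours from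
any set. -/
def IsPartitionChoosable {V : Type u} {k : ℕ} (lam : k.Partition) (G : SimpleGraph V) : Prop :=
  ∀ (C : Type u) (L : V → Finset C), IsPartitionAssignment lam L → IsListColourable G L

/-!
The graph is a sparse version of a dense one. Let `k_1, …, k_q` be the parts of `lam` and
`k'_1, …, k'_r` those of `lam'`, and take `r` disjoint classes of `2 * k'` colours each. The dense graph
`cliqueJoin` is the join of `q` graphs, the `i`-th of which is a disjoint union of cliques of order
`k_i`, one clique for each choice of `k'_j` colours from the `j`-th class for all `j`; the chosen
colours are the list of all vertices of the clique. In a colouring from these lists different parts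
use different colours, so for each class `j` all parts except one, `c j`, leave at least `k'_j`
colours of the class unused. The part `i` contains a clique whose list avoids the colours used in
this part in all classes with `c j ≠ i`. Its `k_i` colours come from the other classes, so
`k_i ≤ ∑_{c j = i} k'_j`. As this holds for all `i`, `lam ≤ lam'`
(`exists_map_of_cliqueJoin_coloring`, `partitionLE_of_map`).

By `exists_sparseLift`, every finite graph `G₀` has lifts of large girth in which a vertex has at most
one neighbour of smaller rank over each vertex of `G₀`, and such that every colouring of the lift with
a given number of colours induces a colouring of `G₀` all of whose edges are seen in the lift. Hence
the lift of the clique join, with the lifted lists, has no list colouring either. On the other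
hand the part of the lift over the `i`-th part of the join has back degrees less than `k_i`, so for every
`lam`-assignment it can be coloured greedily from the `i`-th class of colours
(`SparseLift.isPartitionChoosable`).

The lift is built vertex by vertex, in the manner of Descartes' graphs: the vertices over the new vertex
form a hypergraph without short cycles that has a monochromatic edge in every colouring, and each
edge is matched to a copy of the previous lift. These hypergraphs (`exists_incidenceSparse`) come
from the partite construction of Nešetřil and Rödl. Girth is controlled throughout by counting:
all small substructures have fewer incidences than nodes, as in a forest.
-/

section

open scoped Classical
open Finset

/-! ### Uniform hypergraphs of large girth and large chromatic number -/

/-- A hypergraph whose edges are indexed by `E` and whose edge `b` has the vertices `inc b x`, for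
`x : ι`, is *sparse up to `g`* if every subgraph of its incidence graph that contains between `1`
and `g` edges of the hypergraph (and any set `A` of vertices) has fewer incidences than nodes, as
is the case in a forest. Taking a single edge shows that its vertices are distinct when `g ≥ 1`. -/
def IncidenceSparse {V E ι : Type} [Fintype ι] (inc : E → ι → V) (g : ℕ) : Prop :=
  ∀ (A : Finset V) (B : Finset E), B.Nonempty → #B ≤ g →
    ∑ b ∈ B, #{x | inc b x ∈ A} < #A + #B

theorem IncidenceSparse.mono {V E ι : Type} [Fintype ι] {inc : E → ι → V} {g g' : ℕ}
    (h : IncidenceSparse inc g) (hg : g' ≤ g) : IncidenceSparse inc g' :=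
  fun A B hB hBg => h A B hB (hBg.trans hg)

/-- The embedding of the copy of `V` belonging to `e` into the amalgam of `F` copies of `V`: a
vertex `v` of the part `j` is identified with the vertex `incH e v` of the hypergraph `incH`, and
all other vertices are kept apart. (The amalgam also has the vertices `Sum.inr (e, v)` with `v` in
the part `j`; they are isolated and do no harm.) -/
noncomputable def glueMap {α V F U : Type} (part : V → α) (j : α) (incH : F → V → U) (e : F) (v : V) :
    U ⊕ (F × V) :=
  if part v = j then Sum.inl (incH e v) else Sum.inr (e, v)

/-- Amalgamating copies of a partite hypergraph along one part, as prescribed by a hypergraph that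
is sparse up to `g`, roughly doubles the sparseness: an edge meets the part in at most one vertex,
so a copy containing just one of the given edges cannot take part in a cycle, and at most half as
many copies as there are edges contain at least two of them. -/
theorem IncidenceSparse.amalgam {α V E ι F U : Type} [Fintype V] [Fintype ι] {part : V → α} {j : α}
    {inc : E → ι → V} (hpart : ∀ b, Function.Injective fun x => part (inc b x))
    {incH : F → V → U} {g : ℕ} (hP : IncidenceSparse inc (2 * g + 1))
    (hH : IncidenceSparse incH g) :
    IncidenceSparse (fun (p : F × E) x => glueMap part j incH p.1 (inc p.2 x)) (2 * g + 1) := by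
  intro A B hB hBg
  -- `T` is the set of copies meeting `B`; `Be e`, `Ae e` are the parts of `B`, `A` in the copy `e`
  set T : Finset F := B.image Prod.fst with hT
  set Be : F → Finset E := fun e => (B.filter fun p => p.1 = e).image Prod.snd with hBe
  set AH : Finset U := A.toLeft with hAH
  set Ae : F → Finset V := fun e => univ.filter fun v => Sum.inr (e, v) ∈ A with hAe
  set t : F → ℕ := fun e => #{v | incH e v ∈ AH} with ht
  set s : F → ℕ := fun e => ∑ b ∈ Be e, #{x | glueMap part j incH e (inc b x) ∈ A} with hs
  have hmem : ∀ p : F × E, p ∈ B ↔ p.1 ∈ T ∧ p.2 ∈ Be p.1 := by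
    rintro ⟨e, b⟩
    simp only [hT, hBe, mem_image, mem_filter]
    constructor
    · intro h
      exact ⟨⟨_, h, rfl⟩, _, ⟨h, rfl⟩, rfl⟩
    · rintro ⟨-, p, ⟨h, rfl⟩, rfl⟩
      exact h
  have hTne : T.Nonempty := hB.image _
  have hBene : ∀ e ∈ T, (Be e).Nonempty := by
    intro e he
    obtain ⟨p, hp, rfl⟩ := mem_image.1 he
    exact ⟨p.2, ((hmem p).1 hp).2⟩
  have hsum : ∑ p ∈ B, #{x | glueMap part j incH p.1 (inc p.2 x) ∈ A} = ∑ e ∈ T, s e :=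
    sum_finset_product B T Be hmem
  have hBcard : #B = ∑ e ∈ T, #(Be e) := by
    rw [card_eq_sum_ones, sum_finset_product B T Be hmem]
    simp
  have hAcard : #AH + ∑ e ∈ T, #(Ae e) ≤ #A := by
    have h0 := card_toLeft_add_card_toRight (u := A)
    rw [← hAH] at h0
    have h1 : ∑ e ∈ T, #(Ae e) = #(A.toRight.filter fun p => p.1 ∈ T) := by
      rw [card_eq_sum_ones,
        sum_finset_product (A.toRight.filter fun p => p.1 ∈ T) T Ae
          (by rintro ⟨e, v⟩; simp [hAe, and_comm])]
      simp
    have h2 := card_filter_le A.toRight fun p => p.1 ∈ T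
    omega
  have hBe_le : ∀ e ∈ T, #(Be e) ≤ 2 * g + 1 := fun e he =>
    (single_le_sum (f := fun e => #(Be e)) (fun _ _ => Nat.zero_le _) he).trans (hBcard ▸ hBg)
  -- the vertices of the copy `e` that lie in `A`
  set Ahat : F → Finset V := fun e => univ.filter fun v => glueMap part j incH e v ∈ A with hAhat
  have hs_lt : ∀ e ∈ T, s e < #(Ahat e) + #(Be e) := by
    intro e he
    have := hP (Ahat e) (Be e) (hBene e he) (hBe_le e he)
    simpa [hs, hAhat] using this
  have hAhat_le : ∀ e, #(Ahat e) ≤ #(Ae e) + t e := by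
    intro e
    refine (card_le_card ?_).trans (card_union_le _ _)
    intro v hv
    replace hv := (mem_filter.1 hv).2
    unfold glueMap at hv
    simp only [hAe, hAH, mem_union, mem_filter, mem_univ, true_and, mem_toLeft]
    split_ifs at hv with h
    · exact Or.inr hv
    · exact Or.inl hv
  have hs_one : ∀ e, #(Be e) = 1 → s e ≤ #(Ae e) + 1 := by
    intro e he
    obtain ⟨b, hb⟩ := card_eq_one.1 he
    have hsub : (univ.filter fun x => glueMap part j incH e (inc b x) ∈ A) ⊆
        (univ.filter fun x => inc b x ∈ Ae e) ∪ (univ.filter fun x => part (inc b x) = j) := by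
      intro x hx
      replace hx := (mem_filter.1 hx).2
      unfold glueMap at hx
      simp only [hAe, mem_union, mem_filter, mem_univ, true_and]
      split_ifs at hx with h
      · exact Or.inr h
      · exact Or.inl hx
    have h1 : #{x | inc b x ∈ Ae e} ≤ #(Ae e) := by
      refine card_le_card_of_injOn (inc b) (fun x hx => (mem_filter.1 hx).2) ?_
      intro x _ y _ hxy
      exact hpart b (congrArg part hxy)
    have h2 : #{x | part (inc b x) = j} ≤ 1 := by
      refine card_le_one.2 fun x hx y hy => hpart b ?_
      exact ((mem_filter.1 hx).2).trans ((mem_filter.1 hy).2).symm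
    have h3 := (card_le_card hsub).trans (card_union_le _ _)
    simp only [hs, hb, sum_singleton]
    omega
  suffices h : ∑ e ∈ T, s e < #A + #B by
    rw [← hsum] at h
    convert h
  rcases AH.eq_empty_or_nonempty with hAHe | hAHne
  · have ht0 : ∀ e, t e = 0 := by simp [ht, hAHe]
    have : ∑ e ∈ T, s e < ∑ e ∈ T, (#(Ae e) + #(Be e)) := by
      refine sum_lt_sum_of_nonempty hTne fun e he => ?_
      have h1 := hs_lt e he
      have h2 := hAhat_le e
      rw [ht0] at h2
      omega
    rw [sum_add_distrib] at this
    omega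
  · set T2 : Finset F := T.filter fun e => 2 ≤ #(Be e) with hT2
    have key : ∑ e ∈ T, s e + #T2 ≤ ∑ e ∈ T, (#(Ae e) + #(Be e)) + ∑ e ∈ T2, t e := by
      rw [hT2, card_filter, sum_filter, ← sum_add_distrib, ← sum_add_distrib]
      refine sum_le_sum fun e he => ?_
      have h1 := hs_lt e he
      have h2 := hAhat_le e
      have h3 := hs_one e
      have h4 := (hBene e he).card_pos
      split_ifs with h <;> omega
    rw [sum_add_distrib] at key
    have hpos := hAHne.card_pos
    rcases T2.eq_empty_or_nonempty with h0 | hne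
    · rw [h0] at key
      simp only [card_empty, sum_empty] at key
      omega
    · have h1 : 2 * #T2 ≤ #B := by
        rw [hBcard, mul_comm, ← smul_eq_mul, ← sum_const]
        exact (sum_le_sum fun e he => (mem_filter.1 he).2).trans
          (sum_le_sum_of_subset (filter_subset _ _))
      have h2 := hH AH T2 hne (by omega)
      simp only [ht] at key
      omega

/-- For all `g` and every finite set of colours there is an `ι`-uniform hypergraph that is sparse up
to `g` and has a monochromatic edge in every colouring of its vertices. The sparseness is raised
from `g` to `2 * g + 1` by the partite construction of Nešetřil and Rödl: in a disjoint union of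
edges that represents every choice of `ι` parts out of many, the parts are made monochromatic one
after the other by amalgamation, until the pigeonhole principle applies to the parts.
The colour `c` is part of the conclusion because `ι` may be empty. -/
theorem exists_incidenceSparse (K : Type) [Finite K] [Nonempty K] (g : ℕ) :
    ∀ (ι : Type) [Fintype ι], ∃ (V E : Type) (_ : Fintype V) (_ : Fintype E) (inc : E → ι → V),
      IncidenceSparse inc g ∧ ∀ f : V → K, ∃ e c, ∀ x, f (inc e x) = c := by
  have := Fintype.ofFinite K
  induction g with
  | zero =>
    intro ι _
    refine ⟨Unit, Unit, inferInstance, inferInstance, fun _ _ => (), ?_,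
      fun f => ⟨(), f (), fun _ => rfl⟩⟩
    intro A B hB hB0
    have := hB.card_pos
    omega
  | succ g ih =>
    intro ι _
    let α := Fin (Fintype.card K * Fintype.card ι)
    suffices H : ∀ S : Finset α, ∃ (V E : Type) (_ : Fintype V) (_ : Fintype E) (inc : E → ι → V)
        (part : V → α), (∀ b, Function.Injective fun x => part (inc b x)) ∧
        IncidenceSparse inc (2 * g + 1) ∧
        ∀ (f : V → K) (f₀ : α → K), (∀ v, part v ∉ S → f v = f₀ (part v)) →
          ∃ e c, ∀ x, f (inc e x) = c by
      obtain ⟨V, E, hV, hE, inc, part, -, h1, h2⟩ := H univ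
      refine ⟨V, E, hV, hE, inc, h1.mono (by omega), fun f => ?_⟩
      exact h2 f (fun _ => Classical.arbitrary K) fun v hv => absurd (mem_univ _) hv
    intro S
    induction S using Finset.induction_on with
    | empty =>
      refine ⟨(ι ↪ α) × ι, ι ↪ α, inferInstance, inferInstance, fun φ x => (φ, x),
        fun v => v.1 v.2, fun φ => φ.injective, ?_, ?_⟩
      · intro A B hB _
        have : ∑ b ∈ B, #{x | (b, x) ∈ A} ≤ #A := by
          have h1 := sum_finset_product (A.filter fun p => p.1 ∈ B) B
            (fun b => univ.filter fun x => (b, x) ∈ A) (f := fun _ => 1)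
            (by rintro ⟨e, v⟩; simp [and_comm])
          simp only [sum_const, smul_eq_mul, mul_one] at h1
          rw [← h1]
          exact card_filter_le _ _
        have := hB.card_pos
        have h : ∑ b ∈ B, #{x | (b, x) ∈ A} < #A + #B := by omega
        convert h
      · intro f f₀ hf
        obtain ⟨c, hc⟩ := Fintype.exists_le_card_fiber_of_mul_le_card (n := Fintype.card ι) f₀
          (by simp [α])
        rw [← Fintype.card_coe] at hc
        obtain ⟨φ⟩ := Function.Embedding.nonempty_of_card_le hc
        refine ⟨φ.trans (Function.Embedding.subtype _), c, fun x => ?_⟩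
        rw [hf _ (notMem_empty _)]
        exact (mem_filter.1 (φ x).2).2
    | insert j S hj ihS =>
      obtain ⟨V, E, hV, hE, inc, part, h1, h2, h3⟩ := ihS
      obtain ⟨U, F, hU, hF, incH, h4, h5⟩ := ih V
      refine ⟨U ⊕ (F × V), F × E, inferInstance, inferInstance,
        fun p x => glueMap part j incH p.1 (inc p.2 x), Sum.elim (fun _ => j) fun p => part p.2,
        ?_, h2.amalgam h1 h4, ?_⟩
      · have : ∀ e v, Sum.elim (fun _ => j) (fun p : F × V => part p.2) (glueMap part j incH e v) =
            part v := by
          intro e v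
          unfold glueMap
          split_ifs with h <;> simp [h]
        intro p
        simpa only [this] using h1 p.2
      · intro f f₀ hf
        obtain ⟨e, c, hc⟩ := h5 fun u => f (Sum.inl u)
        obtain ⟨b, d, hd⟩ := h3 (fun v => f (glueMap part j incH e v)) (Function.update f₀ j c) (by
          intro v hv
          by_cases h : part v = j
          · simp [glueMap, h, hc]
          · simp only [glueMap, h, if_false, ne_eq, not_false_eq_true, Function.update_of_ne]
            exact hf (Sum.inr (e, v)) (by simp [h, hv]))
        exact ⟨(e, b), d, hd⟩

/-! ### Sparse lifts of graphs -/

/-- A relation is *sparse up to `g`* if every set `W` of between `1` and `g` vertices contains fewer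
related pairs than vertices, as is the case for an orientation of a forest. -/
def RelSparse {V : Type} (R : V → V → Prop) (g : ℕ) : Prop :=
  ∀ W : Finset V, W.Nonempty → #W ≤ g → #{p ∈ W ×ˢ W | R p.1 p.2} < #W

/-- If each vertex of a set `W` has two neighbours in `W`, then `W` contains at least as many related
pairs as vertices. Applied to the vertices of a cycle this bounds the girth. -/
theorem RelSparse.le_egirth {V : Type} {R : V → V → Prop} {g : ℕ} (hR : RelSparse R g)
    {G : SimpleGraph V} (hG : ∀ x y, G.Adj x y → R x y ∨ R y x) : (g : ℕ∞) ≤ G.egirth := by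
  rw [SimpleGraph.le_egirth]
  intro a w hw
  by_contra! hlt
  have hlt' : w.length < g := by exact_mod_cast hlt
  set W : Finset V := w.support.toFinset with hW
  have hWne : W.Nonempty := ⟨a, by simp [hW]⟩
  have hWcard : #W ≤ w.length := by
    have h1 : W ⊆ w.support.tail.toFinset := by
      intro x hx
      rw [hW, List.mem_toFinset, SimpleGraph.Walk.mem_support_iff] at hx
      rw [List.mem_toFinset]
      rcases hx with rfl | hx
      · exact SimpleGraph.Walk.end_mem_tail_support hw.not_nil
      · exact hx
    refine (card_le_card h1).trans ((List.toFinset_card_le _).trans ?_)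
    simp
  have hdeg : ∀ x ∈ W, 2 ≤ #{y ∈ W | R x y ∨ R y x} := by
    intro x hx
    have hx' : x ∈ w.support := by simpa [hW] using hx
    rw [← hw.ncard_neighborSet_toSubgraph_eq_two hx', ← Set.ncard_coe_finset]
    refine Set.ncard_le_ncard ?_ (Finset.finite_toSet _)
    intro y hy
    rw [SimpleGraph.Subgraph.mem_neighborSet] at hy
    have hy' : y ∈ w.support := by
      have := w.toSubgraph.edge_vert hy.symm
      simpa using this
    simpa [hW, hy'] using hG x y hy.adj_sub
  have h1 : 2 * #W ≤ ∑ x ∈ W, #{y ∈ W | R x y ∨ R y x} := by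
    rw [mul_comm, ← smul_eq_mul, ← sum_const]
    exact sum_le_sum hdeg
  have h2 : ∑ x ∈ W, #{y ∈ W | R x y ∨ R y x} ≤
      ∑ x ∈ W, #{y ∈ W | R x y} + ∑ x ∈ W, #{y ∈ W | R y x} := by
    rw [← sum_add_distrib]
    refine sum_le_sum fun x _ => ?_
    rw [filter_or]
    exact card_union_le _ _
  have h3 : ∑ x ∈ W, #{y ∈ W | R x y} = #{p ∈ W ×ˢ W | R p.1 p.2} := by
    simp only [card_filter, sum_product]
  have h4 : ∑ x ∈ W, #{y ∈ W | R y x} = #{p ∈ W ×ˢ W | R p.1 p.2} := by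
    simp only [card_filter, sum_product_right]
  have := hR W hWne (hWcard.trans hlt'.le)
  omega

/-- The relation of the Descartes-type amalgam: there is a copy of `(V, R)` for each edge `e` of a
hypergraph `inc` on `U`, and each vertex `x` of this copy with `P x` is also related to the
vertex `inc e (some x)` of the hypergraph. -/
def descartesRel {U F V : Type} (inc : F → Option V → U) (P : V → Prop) (R : V → V → Prop) :
    U ⊕ (F × V) → U ⊕ (F × V) → Prop
  | Sum.inl _, _ => False
  | Sum.inr p, Sum.inl u => P p.2 ∧ u = inc p.1 (some p.2)
  | Sum.inr p, Sum.inr p' => p.1 = p'.1 ∧ R p.2 p'.2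

theorem RelSparse.descartesRel {U F V : Type} [Fintype V] {inc : F → Option V → U} (P : V → Prop)
    {R : V → V → Prop} {g : ℕ} (hR : RelSparse R g) (hinc : IncidenceSparse inc g) :
    RelSparse (descartesRel inc P R) g := by
  intro W hW hWg
  set A : Finset U := W.toLeft with hA
  set T : Finset F := W.toRight.image Prod.fst with hT
  set We : F → Finset V := fun e => univ.filter fun v => Sum.inr (e, v) ∈ W with hWe
  have hcard : #W = #A + ∑ e ∈ T, #(We e) := by
    rw [← card_toLeft_add_card_toRight (u := W), hA]
    congr 1
    rw [card_eq_sum_ones, sum_finset_product W.toRight T We]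
    · simp
    · rintro ⟨e, v⟩
      simp only [hT, hWe, mem_image, mem_toRight, mem_filter, mem_univ, true_and]
      exact ⟨fun h => ⟨⟨_, h, rfl⟩, h⟩, fun h => h.2⟩
  have hWene : ∀ e ∈ T, (We e).Nonempty := by
    intro e he
    obtain ⟨p, hp, rfl⟩ := mem_image.1 he
    exact ⟨p.2, by simpa [hWe] using hp⟩
  have hsub : {p ∈ W ×ˢ W | _root_.descartesRel inc P R p.1 p.2} ⊆ T.biUnion fun e =>
      ({p ∈ We e ×ˢ We e | R p.1 p.2}.image fun p => (Sum.inr (e, p.1), Sum.inr (e, p.2))) ∪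
      (({o | inc e o ∈ A} : Finset (Option V)).biUnion fun o => o.toFinset.image fun x =>
        (Sum.inr (e, x), Sum.inl (inc e o))) := by
    rintro ⟨p, p'⟩ h
    rw [mem_filter, mem_product] at h
    obtain ⟨⟨hp, hp'⟩, h⟩ := h
    rcases p with u | ⟨e, x⟩
    · exact h.elim
    have heT : e ∈ T := mem_image.2 ⟨(e, x), mem_toRight.2 hp, rfl⟩
    refine mem_biUnion.2 ⟨e, heT, mem_union.2 ?_⟩
    rcases p' with u | ⟨e', y⟩
    · obtain ⟨-, rfl⟩ := h
      refine Or.inr (mem_biUnion.2 ⟨some x, ?_, ?_⟩)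
      · simpa [hA] using hp'
      · simp
    · obtain ⟨rfl, h⟩ : e = e' ∧ R x y := h
      refine Or.inl (mem_image.2 ⟨(x, y), ?_, rfl⟩)
      simp only [hWe, mem_filter, mem_product, mem_univ, true_and]
      exact ⟨⟨hp, hp'⟩, h⟩
  have hle : #{p ∈ W ×ˢ W | _root_.descartesRel inc P R p.1 p.2} ≤
      ∑ e ∈ T, (#{p ∈ We e ×ˢ We e | R p.1 p.2} + #{o | inc e o ∈ A}) := by
    refine (card_le_card hsub).trans (card_biUnion_le.trans (sum_le_sum fun e _ => ?_))
    refine (card_union_le _ _).trans (add_le_add card_image_le ?_)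
    refine card_biUnion_le.trans ?_
    rw [card_eq_sum_ones]
    refine sum_le_sum fun o _ => card_image_le.trans ?_
    cases o <;> simp
  have hWe_le : ∀ e ∈ T, #(We e) ≤ g := by
    intro e he
    have : #(We e) ≤ ∑ e ∈ T, #(We e) :=
      single_le_sum (f := fun e => #(We e)) (fun _ _ => Nat.zero_le _) he
    omega
  have h1 : ∑ e ∈ T, #{p ∈ We e ×ˢ We e | R p.1 p.2} + #T ≤ ∑ e ∈ T, #(We e) := by
    rw [card_eq_sum_ones, ← sum_add_distrib]
    exact sum_le_sum fun e he => hR (We e) (hWene e he) (hWe_le e he)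
  rw [sum_add_distrib] at hle
  rcases T.eq_empty_or_nonempty with h0 | hne
  · rw [h0] at hle hcard
    simp only [sum_empty] at hle hcard
    have := hW.card_pos
    omega
  · have := hinc A T hne (by omega)
    omega

/-- A *sparse lift* of the part of `G₀` spanned by `s`: a graph on `V`, given by the relation `R`
from each vertex to its neighbours of smaller rank, and a homomorphism `π` from it to `G₀`. The
neighbours of smaller rank of a vertex lie in different fibres of `π`, so back degrees are not
larger than in `G₀`; the relation is sparse up to `g`; and every colouring of the lift by `K` induces
a colouring `f₀` of `s` such that each edge `a b` of `G₀` inside `s` comes from an edge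
of the lift with ends of the colours `f₀ a` and `f₀ b`. -/
structure SparseLift {α : Type} (G₀ : SimpleGraph α) (K : Type) (g : ℕ) (s : Finset α) where
  V : Type
  [fintypeV : Fintype V]
  π : V → α
  R : V → V → Prop
  rank : V → ℕ
  π_mem : ∀ x, π x ∈ s
  rank_lt : ∀ x y, R x y → rank y < rank x
  adj_of_rel : ∀ x y, R x y → G₀.Adj (π x) (π y)
  eq_of_rel : ∀ x y z, R x y → R x z → π y = π z → y = z
  sparse : RelSparse R g
  exists_coloring : ∀ f : V → K, ∃ f₀ : α → K, (∀ a ∈ s, ∃ x, π x = a ∧ f x = f₀ a) ∧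
    ∀ a ∈ s, ∀ b ∈ s, G₀.Adj a b →
      ∃ x y, R x y ∧ (f x = f₀ a ∧ f y = f₀ b ∨ f x = f₀ b ∧ f y = f₀ a)

/-- The vertices of `G₀` are added one by one. The vertices over the new vertex `a` form a hypergraph
that has a monochromatic edge in every colouring, with a copy of the previous lift matched to each
edge; if the edge `e` has the single colour `c`, then `c` and the colouring of the copy at `e`
give the colouring of the larger set. The hypergraph is indexed by `Option V` rather than
`V` so that `c` is the colour of a vertex even if the previous lift is empty. -/
theorem exists_sparseLift {α : Type} (G₀ : SimpleGraph α) (K : Type) [Finite K] [Nonempty K]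
    (g : ℕ) (s : Finset α) : Nonempty (SparseLift G₀ K g s) := by
  induction s using Finset.induction_on with
  | empty =>
    refine ⟨⟨Empty, Empty.elim, fun x => x.elim, fun x => x.elim, fun x => x.elim, fun x => x.elim,
      fun x => x.elim, fun x => x.elim, ?_, fun f => ⟨fun _ => Classical.arbitrary K, ?_, ?_⟩⟩⟩
    · rintro W ⟨x, -⟩
      exact x.elim
    · simp
    · simp
  | insert a s ha ih =>
    obtain ⟨D⟩ := ih
    have := D.fintypeV
    obtain ⟨U, F, hU, hF, inc, hsp, hmono⟩ := exists_incidenceSparse K g (Option D.V)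
    set P : D.V → Prop := fun x => G₀.Adj (D.π x) a with hP
    refine ⟨⟨U ⊕ (F × D.V), Sum.elim (fun _ => a) fun p => D.π p.2, descartesRel inc P D.R,
      Sum.elim (fun _ => 0) fun p => D.rank p.2 + 1, ?_, ?_, ?_, ?_,
      D.sparse.descartesRel P hsp, ?_⟩⟩
    · rintro (u | p)
      · exact mem_insert_self _ _
      · exact mem_insert_of_mem (D.π_mem _)
    · rintro (u | p) (u' | p') h
      · exact h.elim
      · exact h.elim
      · exact Nat.succ_pos _
      · exact Nat.succ_lt_succ (D.rank_lt _ _ h.2)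
    · rintro (u | p) (u' | p') h
      · exact h.elim
      · exact h.elim
      · exact h.1
      · exact D.adj_of_rel _ _ h.2
    · have hne : ∀ x, D.π x ≠ a := fun x h => ha (h ▸ D.π_mem x)
      rintro (u | p) (u' | p') (u'' | p'') h h' heq
      any_goals exact h.elim
      · rw [h.2, h'.2]
      · exact absurd heq.symm (hne _)
      · exact absurd heq (hne _)
      · have := D.eq_of_rel _ _ _ h.2 h'.2 heq
        exact congrArg Sum.inr (Prod.ext (h.1.symm.trans h'.1) this)
    · intro f
      obtain ⟨e, c, hc⟩ := hmono fun u => f (Sum.inl u)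
      obtain ⟨f₀, h1, h2⟩ := D.exists_coloring fun x => f (Sum.inr (e, x))
      have hupd : ∀ b ∈ s, Function.update f₀ a c b = f₀ b := fun b hb =>
        Function.update_of_ne (ne_of_mem_of_not_mem hb ha) _ _
      -- an edge between `a` and an old vertex `b`
      have hnew : ∀ b ∈ s, G₀.Adj b a → ∃ x y, descartesRel inc P D.R x y ∧
          f x = f₀ b ∧ f y = c := by
        intro b hb hba
        obtain ⟨x, rfl, hx⟩ := h1 b hb
        exact ⟨Sum.inr (e, x), Sum.inl (inc e (some x)), ⟨hba, rfl⟩, hx, hc _⟩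
      refine ⟨Function.update f₀ a c, ?_, ?_⟩
      · intro b hb
        rcases mem_insert.1 hb with rfl | hb
        · exact ⟨Sum.inl (inc e none), rfl, by simpa using hc none⟩
        · obtain ⟨x, hx, hfx⟩ := h1 b hb
          exact ⟨Sum.inr (e, x), hx, by rw [hupd b hb]; exact hfx⟩
      · intro b hb b' hb' hadj
        rcases mem_insert.1 hb with rfl | hbs <;> rcases mem_insert.1 hb' with rfl | hbs'
        · exact absurd hadj (G₀.loopless.irrefl _)
        · obtain ⟨x, y, hR, hx, hy⟩ := hnew b' hbs' hadj.symm
          exact ⟨x, y, hR, Or.inr ⟨by rw [hupd _ hbs', hx], by rw [Function.update_self, hy]⟩⟩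
        · obtain ⟨x, y, hR, hx, hy⟩ := hnew b hbs hadj
          exact ⟨x, y, hR, Or.inl ⟨by rw [hupd _ hbs, hx], by rw [Function.update_self, hy]⟩⟩
        · obtain ⟨x, y, hR, h⟩ := h2 b hbs b' hbs' hadj
          rw [hupd _ hbs, hupd _ hbs']
          exact ⟨Sum.inr (e, x), Sum.inr (e, y), ⟨rfl, hR⟩, h⟩

/-! ### The order on partitions -/

theorem sum_partOf {n : ℕ} (lam : n.Partition) : ∑ i, partOf lam i = n := by
  have h : (Finset.univ.val.map (partOf lam)).sum = n := by rw [map_partOf, lam.parts_sum]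
  exact h

theorem partOf_pos {n : ℕ} (lam : n.Partition) (i : Fin lam.parts.card) : 0 < partOf lam i := by
  refine lam.parts_pos ?_
  have h : partOf lam i ∈ Finset.univ.val.map (partOf lam) :=
    Multiset.mem_map_of_mem _ (mem_univ i)
  rwa [map_partOf] at h

/-- Two finite families with the same multiset of values are reindexings of each other. -/
theorem exists_equiv_of_map_univ_eq {ι κ β : Type} [Fintype ι] [Fintype κ] {f : ι → β} {g : κ → β}
    (h : (univ : Finset ι).val.map f = (univ : Finset κ).val.map g) :
    ∃ σ : ι ≃ κ, ∀ i, g (σ i) = f i := by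
  have hcard : ∀ b, Nonempty ({i // f i = b} ≃ {j // g j = b}) := by
    intro b
    refine ⟨Fintype.equivOfCardEq ?_⟩
    have := congrArg (Multiset.count b) h
    rw [Multiset.count_map, Multiset.count_map] at this
    rw [Fintype.card_subtype, Fintype.card_subtype]
    simpa [eq_comm, Finset.card, Finset.filter] using this
  exact ⟨Equiv.ofFiberEquiv fun b => (hcard b).some, fun i => Equiv.ofFiberEquiv_map _ i⟩

/-- Sending the parts of `lam'` to the parts of `lam` in such a way that each part of `lam` receives
at least its own size shows that `lam ≤ lam'`. -/
theorem partitionLE_of_map {k k' : ℕ} {lam : k.Partition} {lam' : k'.Partition}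
    (c : Fin lam'.parts.card → Fin lam.parts.card)
    (hc : ∀ i, partOf lam i ≤ ∑ j with c j = i, partOf lam' j) : PartitionLE lam lam' := by
  set m : Fin lam.parts.card → ℕ := fun i => ∑ j with c j = i, partOf lam' j with hm
  let μ : k'.Partition :=
    { parts := (univ : Finset (Fin lam.parts.card)).val.map m
      parts_pos := by
        intro n hn
        obtain ⟨i, -, rfl⟩ := Multiset.mem_map.1 hn
        exact (partOf_pos lam i).trans_le (hc i)
      parts_sum := by
        have h : ∑ i, m i = k' := by
          rw [← sum_partOf lam']
          exact sum_fiberwise _ c (partOf lam')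
        exact h }
  refine ⟨μ, ?_, ?_⟩
  · rw [← map_partOf lam]
    exact Multiset.rel_map.2 (Multiset.rel_refl_of_refl_on fun i _ => hc i)
  · obtain ⟨σ, hσ⟩ : ∃ σ : Fin μ.parts.card ≃ Fin lam.parts.card, ∀ i, m (σ i) = partOf μ i :=
      exists_equiv_of_map_univ_eq (map_partOf μ)
    refine ⟨fun i =>
      { parts := (univ.filter fun j => c j = σ i).val.map (partOf lam')
        parts_pos := ?_
        parts_sum := ?_ }, ?_⟩
    · intro n hn
      obtain ⟨j, -, rfl⟩ := Multiset.mem_map.1 hn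
      exact partOf_pos lam' j
    · exact hσ i
    · have hsingle : ∀ s : Finset (Fin lam'.parts.card),
          s.val.map (partOf lam') = ∑ j ∈ s, {partOf lam' j} := by
        intro s
        rw [Finset.sum, ← Multiset.sum_map_singleton (s.val.map (partOf lam')), Multiset.map_map]
        rfl
      dsimp only
      rw [Equiv.sum_comp σ fun i => (univ.filter fun j => c j = i).val.map (partOf lam')]
      refine Eq.trans ?_ (map_partOf lam')
      simp only [hsingle]
      exact sum_fiberwise univ c fun j => ({partOf lam' j} : Multiset ℕ)

/-! ### Choosability of sparse lifts -/

/-- Greedy colouring along a rank function, where a conflict arises only between vertices of the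
same part. -/
theorem exists_greedy_coloring {V C β : Type} [Fintype V] [DecidableEq β]
    {R : V → V → Prop} {rank : V → ℕ} (hrank : ∀ x y, R x y → rank y < rank x)
    (p : V → β) (S : V → Finset C)
    (hS : ∀ x, #{y | R x y ∧ p y = p x} < #(S x)) :
    ∃ f : V → C, ∀ x, f x ∈ S x ∧ ∀ y, R x y → p y = p x → f y ≠ f x := by
  have hstep : ∀ (x : V) (ih : ∀ y, rank y < rank x → C),
      ∃ c ∈ S x, ∀ y (h : R x y), p y = p x → ih y (hrank x y h) ≠ c := by
    intro x ih
    set T : Finset C := (univ : Finset {y // R x y ∧ p y = p x}).image fun y =>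
      ih y.1 (hrank x y.1 y.2.1) with hT
    have hlt : #T < #(S x) := by
      refine card_image_le.trans_lt ?_
      rw [card_univ, Fintype.card_subtype]
      exact hS x
    obtain ⟨c, hc, hcT⟩ := exists_mem_notMem_of_card_lt_card hlt
    refine ⟨c, hc, fun y h hy heq => hcT ?_⟩
    exact mem_image.2 ⟨⟨y, h, hy⟩, mem_univ _, heq⟩
  choose F hF1 hF2 using hstep
  have hwf : WellFounded fun x y : V => rank x < rank y := (measure rank).wf
  have hfix : ∀ x, hwf.fix F x = F x fun y _ => hwf.fix F y := fun x => hwf.fix_eq F x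
  refine ⟨hwf.fix F, fun x => ?_⟩
  rw [hfix x]
  exact ⟨hF1 _ _, fun y hy hp => hF2 x (fun y _ => hwf.fix F y) y hy hp⟩

/-- The graph of a sparse lift. -/
def SparseLift.graph {α : Type} {G₀ : SimpleGraph α} {K : Type} {g : ℕ} {s : Finset α}
    (D : SparseLift G₀ K g s) : SimpleGraph D.V :=
  SimpleGraph.fromRel D.R

theorem SparseLift.le_egirth {α : Type} {G₀ : SimpleGraph α} {K : Type} {g : ℕ} {s : Finset α}
    (D : SparseLift G₀ K g s) : (g : ℕ∞) ≤ D.graph.egirth :=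
  D.sparse.le_egirth fun x y h => ((SimpleGraph.fromRel_adj _ x y).1 h).2

/-- If the vertices of `G₀` are divided into parts, one for each part of `lam`, such that a vertex has
fewer neighbours in its own part than the corresponding part of `lam`, then every sparse lift of `G₀`
is `lam`-choosable: the fibres of the part `i` are coloured greedily with the colours of the `i`-th
class. -/
theorem SparseLift.isPartitionChoosable {α : Type} {G₀ : SimpleGraph α} {K : Type} {g : ℕ}
    {s : Finset α} (D : SparseLift G₀ K g s) {k : ℕ} (lam : k.Partition)
    (part : α → Fin lam.parts.card)
    (hdeg : ∀ a, #{b ∈ s | G₀.Adj a b ∧ part b = part a} < partOf lam (part a)) :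
    IsPartitionChoosable lam D.graph := by
  have := D.fintypeV
  rintro C L ⟨-, A, hdisj, -, hA⟩
  obtain ⟨f, hf⟩ := exists_greedy_coloring D.rank_lt (fun x => part (D.π x))
    (fun x => (L x).filter fun c => c ∈ A (part (D.π x))) (by
      intro x
      have h1 : #{c ∈ L x | c ∈ A (part (D.π x))} = partOf lam (part (D.π x)) := by
        rw [← hA x, ← Set.ncard_coe_finset, coe_filter]
        rfl
      rw [h1]
      refine lt_of_le_of_lt ?_ (hdeg (D.π x))
      refine card_le_card_of_injOn D.π ?_ ?_
      · intro y hy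
        obtain ⟨-, hR, hp⟩ := mem_filter.1 hy
        exact mem_filter.2 ⟨D.π_mem y, D.adj_of_rel _ _ hR, hp⟩
      · intro y hy z hz heq
        exact D.eq_of_rel x y z (mem_filter.1 hy).2.1 (mem_filter.1 hz).2.1 heq)
  have hne : ∀ x y, D.R x y → f x ≠ f y := by
    intro x y hR heq
    by_cases hp : part (D.π y) = part (D.π x)
    · exact (hf x).2 y hR hp heq.symm
    · have hx := (mem_filter.1 (hf x).1).2
      have hy := (mem_filter.1 (hf y).1).2
      exact Set.disjoint_left.1 (hdisj hp) hy (heq ▸ hx)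
  refine ⟨SimpleGraph.Coloring.mk f ?_, fun x => (mem_filter.1 (hf x).1).1⟩
  intro x y hadj
  rcases ((SimpleGraph.fromRel_adj _ x y).1 hadj).2 with h | h
  · exact hne x y h
  · exact (hne y x h).symm

/-! ### The join of unions of cliques -/

/-- The vertices of the graph that is lifted: the part `i` is a disjoint union of cliques with `κ i`
vertices, one for each choice `S` of subsets with `κ' j` elements of the colour classes
`{j} × Fin N`. The union of these subsets is the common list of the vertices of the clique. -/
abbrev CliqueVertex {ι ι' : Type} (κ : ι → ℕ) (κ' : ι' → ℕ) (N : ℕ) : Type :=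
  Σ i : ι, {S : ι' → Finset (Fin N) // ∀ j, #(S j) = κ' j} × Fin (κ i)

/-- The join of the parts: vertices of different parts are adjacent, and distinct vertices of the
same part are adjacent if they lie in the same clique. -/
def cliqueJoin {ι ι' : Type} (κ : ι → ℕ) (κ' : ι' → ℕ) (N : ℕ) :
    SimpleGraph (CliqueVertex κ κ' N) where
  Adj a b := (a.1 = b.1 → a.2.1 = b.2.1) ∧ a ≠ b
  symm := ⟨fun _ _ h => ⟨fun e => (h.1 e.symm).symm, h.2.symm⟩⟩
  loopless := ⟨fun _ h => h.2 rfl⟩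

theorem cliqueJoin_degree_lt {ι ι' : Type} (κ : ι → ℕ) (κ' : ι' → ℕ) (N : ℕ)
    (s : Finset (CliqueVertex κ κ' N)) (a : CliqueVertex κ κ' N) :
    #{b ∈ s | (cliqueJoin κ κ' N).Adj a b ∧ b.1 = a.1} < κ a.1 := by
  obtain ⟨i, S, t⟩ := a
  have hsub : {b ∈ s | (cliqueJoin κ κ' N).Adj ⟨i, S, t⟩ b ∧ b.1 = i} ⊆
      (univ.erase t).image fun t' => (⟨i, S, t'⟩ : CliqueVertex κ κ' N) := by
    rintro ⟨i', S', t'⟩ hb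
    obtain ⟨-, hadj, rfl⟩ := mem_filter.1 hb
    obtain rfl : S = S' := hadj.1 rfl
    refine mem_image.2 ⟨t', mem_erase.2 ⟨?_, mem_univ _⟩, rfl⟩
    rintro rfl
    exact hadj.2 rfl
  refine (card_le_card hsub).trans_lt (card_image_le.trans_lt ?_)
  rw [card_erase_of_mem (mem_univ t), card_univ, Fintype.card_fin]
  exact Nat.sub_lt (Fin.pos t) one_pos

/-- If the clique join has a colouring from the lists of its cliques, then each class `j` can be sent
to a part `c j` such that each part `i` receives classes of total list size at least `κ i`.
Different parts use different colours, so all parts but at most one, which is taken as `c j`, leave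
half of the class `j` unused. In the part `i` there is then a clique whose list in every class `j`
with `c j ≠ i` consists of colours not used in this part, so its `κ i` colours lie in the remaining
classes. -/
theorem exists_map_of_cliqueJoin_coloring {ι ι' : Type} [Nonempty ι] [Fintype ι'] {κ : ι → ℕ}
    {κ' : ι' → ℕ} {N : ℕ} (hN : ∀ j, 2 * κ' j ≤ N) (f : CliqueVertex κ κ' N → ι' × Fin N)
    (hmem : ∀ a, (f a).2 ∈ a.2.1.1 (f a).1)
    (hadj : ∀ a b, (cliqueJoin κ κ' N).Adj a b → f a ≠ f b) :
    ∃ c : ι' → ι, ∀ i, κ i ≤ ∑ j with c j = i, κ' j := by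
  -- the colours of the class `j` that are used in the part `i`
  set D : ι → ι' → Finset (Fin N) := fun i j => univ.filter fun x => ∃ a, a.1 = i ∧ f a = (j, x)
    with hD
  have hdisj : ∀ i i' j, i ≠ i' → D i j ⊆ (D i' j)ᶜ := by
    intro i i' j hne x hx
    obtain ⟨-, a, rfl, hfa⟩ := mem_filter.1 hx
    refine mem_compl.2 fun hx' => ?_
    obtain ⟨-, b, rfl, hfb⟩ := mem_filter.1 hx'
    refine hadj a b ⟨fun h => absurd h hne, ?_⟩ (hfa.trans hfb.symm)
    rintro rfl
    exact hne rfl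
  have hc : ∀ j, ∃ c, ∀ i, c ≠ i → κ' j ≤ #(D i j)ᶜ := by
    intro j
    by_cases h : ∃ i, #(D i j)ᶜ < κ' j
    · obtain ⟨i, hi⟩ := h
      refine ⟨i, fun i' hne => ?_⟩
      have h1 := card_le_card (hdisj i' i j hne.symm)
      have h2 := card_add_card_compl (D i' j)
      have h3 := hN j
      rw [Fintype.card_fin] at h2
      omega
    · push Not at h
      exact ⟨Classical.arbitrary ι, fun i _ => h i⟩
  choose c hc using hc
  refine ⟨c, fun i => ?_⟩
  have hS : ∀ j, ∃ S : Finset (Fin N), #S = κ' j ∧ (c j ≠ i → S ⊆ (D i j)ᶜ) := by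
    intro j
    by_cases h : c j = i
    · obtain ⟨S, -, hS⟩ := exists_subset_card_eq (s := (univ : Finset (Fin N))) (n := κ' j) (by
        have := hN j
        rw [card_univ, Fintype.card_fin]
        omega)
      exact ⟨S, hS, fun h' => absurd h h'⟩
    · obtain ⟨S, hS, hcard⟩ := exists_subset_card_eq (hc j i h)
      exact ⟨S, hcard, fun _ => hS⟩
  choose S hS1 hS2 using hS
  set a : Fin (κ i) → CliqueVertex κ κ' N := fun t => ⟨i, ⟨S, hS1⟩, t⟩ with ha
  have hinj : Function.Injective fun t => f (a t) := by
    intro t t' heq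
    by_contra hne
    refine hadj (a t) (a t') ⟨fun _ => rfl, fun h => hne ?_⟩ heq
    simpa [ha] using h
  have hmaps : ∀ t, f (a t) ∈ (univ.filter fun j => c j = i).biUnion fun j =>
      (S j).image fun x => (j, x) := by
    intro t
    have hm : (f (a t)).2 ∈ S (f (a t)).1 := hmem (a t)
    refine mem_biUnion.2 ⟨(f (a t)).1, mem_filter.2 ⟨mem_univ _, ?_⟩, mem_image.2 ⟨_, hm, rfl⟩⟩
    by_contra hne
    exact mem_compl.1 (hS2 _ hne hm) (mem_filter.2 ⟨mem_univ _, a t, rfl, rfl⟩)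
  calc κ i = #(univ : Finset (Fin (κ i))) := by rw [card_univ, Fintype.card_fin]
    _ ≤ _ := card_le_card_of_injOn _ (fun t _ => hmaps t) (hinj.injOn)
    _ ≤ ∑ j with c j = i, κ' j := by
      refine card_biUnion_le.trans (sum_le_sum fun j _ => ?_)
      exact card_image_le.trans (hS1 j).le

/-- Lists that consist of `κ' j` colours of each class `{j} × Fin N`, with the parts of a partition
as `κ'`, form an assignment for this partition. -/
theorem isPartitionAssignment_of_classes {k N : ℕ} (lam : k.Partition) {V : Type}
    (S : V → Fin lam.parts.card → Finset (Fin N)) (hS : ∀ v j, #(S v j) = partOf lam j) :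
    IsPartitionAssignment lam fun v =>
      (univ.filter fun c : Fin lam.parts.card × Fin N => c.2 ∈ S v c.1) := by
  refine ⟨fun v => ?_, fun j => {c | c.1 = j ∧ ∃ v, c.2 ∈ S v c.1}, ?_, ?_, ?_⟩
  · have := sum_finset_product (univ.filter fun c : Fin lam.parts.card × Fin N => c.2 ∈ S v c.1)
      univ (S v) (f := fun _ => 1) (by simp)
    simp only [sum_const, smul_eq_mul, mul_one, hS] at this
    rw [this, sum_partOf]
  · intro i j hij
    refine Set.disjoint_left.2 ?_
    rintro c ⟨rfl, -⟩ ⟨h, -⟩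
    exact hij h
  · ext c
    simp
  · intro v j
    have : (((univ.filter fun c : Fin lam.parts.card × Fin N => c.2 ∈ S v c.1) :
        Finset _) : Set (Fin lam.parts.card × Fin N)) ∩ {c | c.1 = j ∧ ∃ v, c.2 ∈ S v c.1} =
        ((S v j).image fun x => (j, x) : Finset _) := by
      ext ⟨i, x⟩
      simp only [coe_filter, mem_univ, true_and, Set.mem_inter_iff, Set.mem_ofPred_eq, coe_image,
        Set.mem_image, mem_coe, Prod.mk.injEq]
      constructor
      · rintro ⟨h, rfl, -⟩
        exact ⟨x, h, rfl, rfl⟩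
      · rintro ⟨y, h, rfl, rfl⟩
        exact ⟨h, rfl, v, h⟩
    rw [this, Set.ncard_coe_finset, card_image_of_injective _ (Prod.mk_right_injective j), hS]

end

theorem theorem2 (k k' : ℕ) (hk : 0 < k) (hk' : 0 < k')
    (lam : k.Partition) (lam' : k'.Partition) (hle : ¬ PartitionLE lam lam')
    (g : ℕ) (hg : 0 < g) :
    ∃ (V : Type) (_ : Fintype V) (G : SimpleGraph V),
      (g : ℕ∞) ≤ G.egirth ∧ IsPartitionChoosable lam G ∧ ¬ IsPartitionChoosable lam' G := by
  classical
  have hne : ∀ {n : ℕ} (l : n.Partition), 0 < n → Nonempty (Fin l.parts.card) := by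
    intro n l hn
    by_contra h
    rw [not_nonempty_iff] at h
    have := sum_partOf l
    rw [Finset.univ_eq_empty, Finset.sum_empty] at this
    omega
  have := hne lam hk
  have := hne lam' hk'
  have : NeZero (2 * k') := ⟨by omega⟩
  -- classes of `2 * k'` colours have room for two disjoint sets of any part of `lam'`
  let G₀ := cliqueJoin (partOf lam) (partOf lam') (2 * k')
  obtain ⟨D⟩ := exists_sparseLift G₀ (Fin lam'.parts.card × Fin (2 * k')) g Finset.univ
  refine ⟨D.V, D.fintypeV, D.graph, D.le_egirth, ?_, fun hch => hle ?_⟩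
  · exact D.isPartitionChoosable lam Sigma.fst fun a => by
      convert cliqueJoin_degree_lt (partOf lam) (partOf lam') (2 * k') Finset.univ a
  obtain ⟨φ, hφ⟩ := hch _ _ (isPartitionAssignment_of_classes lam' (fun x => (D.π x).2.1.1)
    fun x => (D.π x).2.1.2)
  obtain ⟨f₀, h1, h2⟩ := D.exists_coloring φ
  obtain ⟨c, hc⟩ := exists_map_of_cliqueJoin_coloring (κ := partOf lam) (κ' := partOf lam')
    (N := 2 * k')
    (fun j => Nat.mul_le_mul_left 2 <| by
      conv_rhs => rw [← sum_partOf lam']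
      exact Finset.single_le_sum (fun _ _ => Nat.zero_le _) (Finset.mem_univ j)) f₀
    (fun a => by
      obtain ⟨x, rfl, hx⟩ := h1 a (Finset.mem_univ _)
      rw [← hx]
      exact (Finset.mem_filter.1 (hφ x)).2)
    (fun a b hab heq => by
      obtain ⟨x, y, hR, h⟩ := h2 a (Finset.mem_univ _) b (Finset.mem_univ _) hab
      have hxy : x ≠ y := fun e => (D.rank_lt x y hR).ne (by rw [e])
      have hadj : D.graph.Adj x y := (SimpleGraph.fromRel_adj _ x y).2 ⟨hxy, Or.inl hR⟩
      rcases h with ⟨hx, hy⟩ | ⟨hx, hy⟩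
      · exact φ.valid hadj (hx.trans (heq.trans hy.symm))
      · exact φ.valid hadj (hx.trans (heq.symm.trans hy.symm)))
  exact partitionLE_of_map c fun i => by convert hc i
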